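/- Let $\mathbb{K}$ be a field and let $Q$ be a quiver with (not necessarily finite) vertex set $Q_0$ such that for all $i,j\in Q_0$ the set $Q(i,j)$ of arrows from $i$ to $j$ is finite. Assume that $Q$ is symmetric, i.e. $|Q(i,j)|=|Q(j,i)|$ for all $i,j\in Q_0$. On $\mathbb{Z}^{\oplus Q_0}$ let $$(d,e)=\sum_{i\in Q_0} d_ie_i-\sum_{\alpha:i\to j} d_ie_j,$$ the second sum running over all arrows of $Q$. Let $d=(d_i)\in\mathbb{N}^{\oplus Q_0}$ be a dimension vector, put $|d|=\sum_{i\in Q_0} d_i$, and let the algebraic group $G_d=\prod_{i\in Q_0}\mathrm{GL}_{d_i}$ over $\mathbb{K}$ act on the affine space $R_d=\prod_{\alpha:i\to j}\mathrm{Hom}(\mathbb{K}^{d_i},\mathbb{K}^{d_j})$ by simultaneous conjugation, $(g\cdot x)_\alpha=g_jx_\alpha g_i^{-1}$ for $\alpha:i\to j$. Let $\mathbb{K}[R_d]^{G_d}$ be the ring of functions on $R_d$ invariant under the group scheme $G_d$, let $\rho:R_d\to\operatorname{Spec}\mathbb{K}[R_d]^{G_d}$ be the quotient map, and let $N_d=\rho^{-1}(\rho(0))\subset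 R_d$ be the nullcone. Then $$\dim N_d-\dim G_d\le -\frac12(d,d)+\frac12\sum_{k\in Q_0}(k,k)\,d_k-|d|,$$ where $\dim$ is the Krull dimension, and in $(k,k)$ the vertex $k$ is identified with the dimension vector $(\delta_{ik})_{i\in Q_0}$. -/

import Mathlib

universe u v w

noncomputable section

namespace SymQuiver

variable {V : Type v} [Quiver.{w} V]

/-- A quiver (with finitely many arrows between any two vertices) is symmetric if, for all
vertices `i`, `j`, there are as many arrows from `i` to `j` as from `j` to `i`. -/
def IsSymmetric (V : Type v) [Quiver.{w} V] : Prop :=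
  ∀ i j : V, Nat.card (i ⟶ j) = Nat.card (j ⟶ i)

/-- The Euler pairing `(d, e) = ∑_i d_i e_i - ∑_{a : i → j} d_i e_j` on finitely supported integer
vectors; the second sum is grouped by the pair `(i, j)` of end points. -/
def eulerPairing (d e : V →₀ ℤ) : ℤ :=
  (d.sum fun i m => m * e i) -
    d.sum fun i m => e.sum fun j n => (Nat.card (i ⟶ j) : ℤ) * (m * n)

/-- A dimension vector, regarded as an integer vector. -/
def intVec (d : V →₀ ℕ) : V →₀ ℤ := d.mapRange (Nat.cast : ℕ → ℤ) Nat.cast_zero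

/-- The `A`-valued points of the representation space
`R_d = ∏_{a : i → j} Hom(K^{d_i}, K^{d_j})`. -/
abbrev RepSpace (d : V →₀ ℕ) (A : Type*) : Type _ :=
  ∀ i j : V, (i ⟶ j) → Matrix (Fin (d j)) (Fin (d i)) A

/-- The `A`-valued points of the group scheme `G_d = ∏_i GL_{d_i}`. -/
abbrev GaugeGroup (d : V →₀ ℕ) (A : Type*) [CommRing A] : Type _ :=
  ∀ i : V, Matrix.GeneralLinearGroup (Fin (d i)) A

/-- The action of `G_d` on `R_d` by simultaneous conjugation, on `A`-valued points:
`(g · x)_a = g_j x_a g_i⁻¹` for an arrow `a : i → j`. -/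
def conjAct {d : V →₀ ℕ} {A : Type*} [CommRing A] (g : GaugeGroup d A) (x : RepSpace d A) :
    RepSpace d A :=
  fun i j a => (g j : Matrix (Fin (d j)) (Fin (d j)) A) * x i j a *
    ((g i)⁻¹ : Matrix.GeneralLinearGroup (Fin (d i)) A).val

/-- The index set of the coordinate functions on `R_d`: an arrow `i → j` together with the
position of an entry of a `d_j × d_i` matrix. -/
abbrev RepCoord (d : V →₀ ℕ) : Type _ :=
  (i : V) × (j : V) × (_ : i ⟶ j) × (Fin (d j) × Fin (d i))

/-- The coordinate ring `K[R_d]`. -/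
abbrev RepRing (K : Type u) [Field K] (d : V →₀ ℕ) : Type _ :=
  MvPolynomial (RepCoord d) K

/-- The value of a function on `R_d` at an `A`-valued point. -/
def evalAt {K : Type u} [Field K] {d : V →₀ ℕ} {A : Type*} [CommRing A] [Algebra K A]
    (x : RepSpace d A) : RepRing K d →ₐ[K] A :=
  MvPolynomial.aeval fun c => x c.1 c.2.1 c.2.2.1 c.2.2.2.1 c.2.2.2.2

/-- The ring `K[R_d]^{G_d}` of functions invariant under the group scheme `G_d`: those `f` with
`f (g · x) = f x` for all points `g` of `G_d` and `x` of `R_d` with values in any commutative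
`K`-algebra. (Since `K[G_d × R_d]` is among these algebras, this is the same as being coinvariant
for the coaction of `K[G_d]`. For a small field, the `K`-valued points would not suffice.) -/
def invariantRing (K : Type u) [Field K] (d : V →₀ ℕ) : Subalgebra K (RepRing K d) where
  carrier := {f | ∀ (A : Type (max u v w)) [CommRing A] [Algebra K A]
    (g : GaugeGroup d A) (x : RepSpace d A), evalAt (conjAct g x) f = evalAt x f}
  mul_mem' hf hg A _ _ g x := by rw [map_mul, map_mul, hf A g x, hg A g x]
  add_mem' hf hg A _ _ g x := by rw [map_add, map_add, hf A g x, hg A g x]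
  algebraMap_mem' r A _ _ g x := by rw [AlgHom.commutes, AlgHom.commutes]

/-- The quotient map `ρ : R_d = Spec K[R_d] → Spec K[R_d]^{G_d}`. -/
def quotientMap (K : Type u) [Field K] (d : V →₀ ℕ) :
    PrimeSpectrum (RepRing K d) → PrimeSpectrum (invariantRing K d) :=
  PrimeSpectrum.comap (algebraMap (invariantRing K d) (RepRing K d))

/-- The origin of `R_d`: the maximal ideal of all functions vanishing at the zero
representation. -/
def origin (K : Type u) [Field K] (d : V →₀ ℕ) : PrimeSpectrum (RepRing K d) :=
  ⟨RingHom.ker (evalAt (0 : RepSpace d K)), RingHom.ker_isPrime _⟩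

/-- The nullcone `N_d = ρ⁻¹(ρ(0))`. -/
def nullcone (K : Type u) [Field K] (d : V →₀ ℕ) : Set (PrimeSpectrum (RepRing K d)) :=
  quotientMap K d ⁻¹' {quotientMap K d (origin K d)}

/-- The coordinate ring `K[G_d]`: polynomials in the entries of square matrices of sizes `d_i`,
with the determinants inverted. -/
abbrev GaugeRing (K : Type u) [Field K] (d : V →₀ ℕ) : Type _ :=
  Localization.Away (∏ i ∈ d.support, Matrix.det (Matrix.of fun r c : Fin (d i) =>
    (MvPolynomial.X ⟨i, r, c⟩ : MvPolynomial ((i : V) × (Fin (d i) × Fin (d i))) K)))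

end SymQuiver

end

/-!
A point of the nullcone is a nilpotent representation, and a nilpotent representation can be written
down with few parameters.

Let `x` be the tautological representation at a point `P` of the nullcone, over the fraction field
of `K[R_d] / P`. Every word in the arrows acts on the total space of a representation by a matrix,
and the coefficients of its characteristic polynomial are invariant
(`charpoly_coeff_mem_invariantRing`); apart from the leading one they vanish at the origin, hence at
`P`. So all nonempty words act nilpotently (`nilpotentWords_of_mem_nullcone`). No generators of the
invariant ring have to be known for this.

By Levitzki's theorem on semigroups of nilpotent operators (`exists_common_kernel_vector`), a
nilpotent representation contains a nonzero vector `v` at some vertex `k` that is killed by all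
arrows. Scale `v` so that its coordinate at some basis vector `p` is `1`. The representation is then
determined by its quotient by `v`, by the remaining `d_k - 1` coordinates of `v`, and by the row `p`
of the arrows into `k`, outside the column `p`. By induction on the dimension, all entries of `x`
are polynomials in a number of elements of the field, where that number counts, for each unordered
pair of basis vectors of the total space, one parameter if they sit at the same vertex and one for
each arrow from one to the other; symmetry of the quiver makes the count independent of the order in
which the basis vectors are removed (`pairCount_eq_add_remove`, `exists_finset_mem_adjoin`). This
is the dimension of `G_d ×^B n` for a Borel subgroup `B` and the corresponding strictly upper
triangular representations `n`. It bounds the transcendence degree, and so by Noether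
normalization the dimension, of `K[R_d] / P` (`ringKrullDim_le_card_of_mem_adjoin`).

The group `G_d` is a nonempty principal open subset of an affine space, so its dimension is
`∑ d_i²`, and the inequality follows by rewriting the count with the Euler pairing
(`pairCount_totalBasis`).
-/

namespace SymQuiver

/-! ### Krull dimension of affine algebras -/

lemma ringKrullDim_le_of_isIntegral {R S : Type*} [CommRing R] [CommRing S] (f : R →+* S)
    (hf : f.IsIntegral) : ringKrullDim S ≤ ringKrullDim R := by
  algebraize [f]
  exact Order.krullDim_le_of_strictMono (PrimeSpectrum.comap (algebraMap R S)) fun P Q h =>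
    Ideal.IsIntegral.comap_lt_comap (R := R) (I := P.asIdeal) (J := Q.asIdeal) h

/-- The dimension of an affine domain is bounded by the number of elements of an extension field
needed to write down its members: Noether normalization turns the dimension into a number of
algebraically independent elements. -/
lemma ringKrullDim_le_card_of_mem_adjoin {K B L : Type*} [Field K] [CommRing B] [Nontrivial B]
    [Algebra K B] [Algebra.FiniteType K B] [Field L] [Algebra K L] (f : B →ₐ[K] L)
    (hf : Function.Injective f) (t : Finset L) (ht : ∀ b, f b ∈ Algebra.adjoin K (t : Set L)) :
    ringKrullDim B ≤ t.card := by
  obtain ⟨s, g, hg, hint⟩ := exists_integral_inj_algHom_of_fg K B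
  have h1 := ringKrullDim_le_of_isIntegral _ hint
  rw [MvPolynomial.ringKrullDim_of_isNoetherianRing, ringKrullDim_eq_zero_of_field, zero_add,
    Nat.card_fin] at h1
  refine h1.trans ?_
  have hind : AlgebraicIndependent K fun i : Fin s => f (g (MvPolynomial.X i)) := by
    have : MvPolynomial.aeval (fun i : Fin s => f (g (MvPolynomial.X i))) = f.comp g := by
      ext i; simp
    rw [AlgebraicIndependent, this]
    exact hf.comp hg
  set A := Algebra.adjoin K (t : Set L)
  have hind' : AlgebraicIndependent K
      fun i : Fin s => (⟨f (g (MvPolynomial.X i)), ht _⟩ : A) :=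
    AlgebraicIndependent.of_comp (f := A.val) hind
  have h2 := hind'.lift_cardinalMk_le_trdeg
  let T : Set A := Subtype.val ⁻¹' (t : Set L)
  have hT : Algebra.adjoin K T = ⊤ := Algebra.adjoin_adjoin_coe_preimage
  have : Algebra.IsAlgebraic (Algebra.adjoin K T) A := by
    refine ⟨fun x => ?_⟩
    exact isAlgebraic_algebraMap (A := A) (⟨x, hT ▸ Algebra.mem_top⟩ : Algebra.adjoin K T)
  have h3 := Algebra.IsAlgebraic.trdeg_le_cardinalMk K T
  have h4 : Cardinal.mk T ≤ t.card := by
    rw [← Cardinal.mk_coe_finset]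
    exact Cardinal.mk_le_of_injective (f := fun x : T => (⟨x.1.1, x.2⟩ : (t : Set L)))
      fun x y h => Subtype.ext (Subtype.ext (by simpa using congrArg Subtype.val h))
  have h5 := h3.trans h4
  simp only [Cardinal.mk_fin, Cardinal.lift_natCast, Cardinal.lift_id'] at h2
  exact_mod_cast h2.trans h5

lemma height_eq_card_of_isMaximal {K σ : Type*} [Field K] [Finite σ]
    (M : Ideal (MvPolynomial σ K)) (hM : M.IsMaximal) : M.height = Nat.card σ := by
  induction σ using Finite.induction_empty_option with
  | of_equiv e IH =>
    let φ := (MvPolynomial.renameEquiv K e).toRingEquiv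
    have := Ideal.comap_isMaximal_of_equiv φ (p := M)
    rw [← φ.height_comap M, IH _ this, Nat.card_congr e]
  | h_empty =>
    have h := Ideal.height_le_ringKrullDim_of_ne_top hM.ne_top
    rw [MvPolynomial.ringKrullDim_of_isNoetherianRing] at h
    simpa using h
  | @h_option α _ IH =>
    let φ := (MvPolynomial.optionEquivLeft K α).toRingEquiv.symm
    have := Ideal.comap_isMaximal_of_equiv φ (p := M)
    rw [← φ.height_comap M]
    set Q := M.comap φ
    have hQ : (Q.under (MvPolynomial α K)).IsMaximal :=
      Polynomial.isMaximal_comap_C_of_isJacobsonRing Q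
    have : Q.LiesOver (Q.under (MvPolynomial α K)) := ⟨rfl⟩
    rw [Polynomial.height_eq_height_add_one (Q.under (MvPolynomial α K)) Q, IH _ hQ]
    simp

/-- All maximal ideals of a polynomial ring over a field have the same height, so that inverting a
nonzero polynomial does not lower the dimension. -/
lemma ringKrullDim_away_mvPolynomial {K σ : Type*} [Field K] [Finite σ] (f : MvPolynomial σ K)
    (hf : f ≠ 0) : ringKrullDim (Localization.Away f) = Nat.card σ := by
  have key : ∀ Q : Ideal (Localization.Away f), Q.IsMaximal → Q.height = Nat.card σ := by
    intro Q hQ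
    rw [← IsLocalization.height_under (Submonoid.powers f) Q]
    exact height_eq_card_of_isMaximal _
      ((IsLocalization.isMaximal_iff_isMaximal_disjoint _ f Q).1 hQ).1
  have : Nontrivial (Localization.Away f) :=
    (IsLocalization.injective (M := Submonoid.powers f) (Localization.Away f)
      (powers_le_nonZeroDivisors_of_noZeroDivisors hf)).nontrivial
  refine le_antisymm ?_ ?_
  · rw [ringKrullDim_le_iff_isMaximal_height_le]
    intro m hm
    rw [key m hm]
    rfl
  · obtain ⟨m, hm⟩ := Ideal.exists_maximal (Localization.Away f)
    have := Ideal.height_le_ringKrullDim_of_ne_top hm.ne_top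
    rwa [key m hm] at this

lemma topologicalKrullDim_zeroLocus {R : Type*} [CommRing R] (I : Ideal R) :
    topologicalKrullDim (PrimeSpectrum.zeroLocus (I : Set R)) = ringKrullDim (R ⧸ I) := by
  have h := PrimeSpectrum.isClosedEmbedding_comap_of_surjective _ _
    (Ideal.Quotient.mk_surjective (I := I))
  have hr := range_comap_of_surjective _ _ (Ideal.Quotient.mk_surjective (I := I))
  rw [Ideal.mk_ker] at hr
  rw [← hr, ← PrimeSpectrum.topologicalKrullDim_eq_ringKrullDim]
  exact (IsHomeomorph.topologicalKrullDim_eq _ h.isEmbedding.toHomeomorph.isHomeomorph).symm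

lemma ringKrullDim_quotient_le_of_forall_isPrime {R : Type*} [CommRing R] (I : Ideal R)
    (n : WithBot ℕ∞) (h : ∀ P : Ideal R, P.IsPrime → I ≤ P → ringKrullDim (R ⧸ P) ≤ n) :
    ringKrullDim (R ⧸ I) ≤ n := by
  rw [ringKrullDim_quotient]
  refine iSup_le fun l => ?_
  have h0 := h (l 0).1.asIdeal (l 0).1.isPrime (l 0).2
  rw [ringKrullDim_quotient] at h0
  refine le_trans ?_ h0
  exact Order.LTSeries.length_le_krullDim
    (⟨l.length, fun i => ⟨(l i).1, (l.monotone (Fin.zero_le i) : l 0 ≤ l i)⟩, fun i => l.step i⟩ :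
      LTSeries (PrimeSpectrum.zeroLocus ((l 0).1.asIdeal : Set R)))

/-! ### Semigroups of nilpotent operators -/

/-- Levitzki's theorem, in the form of a common kernel vector: if `S` is closed under composition
and consists of nilpotent operators, then every nonzero `S`-stable subspace contains a nonzero
vector killed by `S`. If `a ∈ S` has minimal nonzero rank on `W`, then `a s a` vanishes on `W` for
every `s ∈ S`, so that `a W + S a W` is a smaller `S`-stable subspace. -/
lemma exists_common_kernel_vector {L E : Type*} [Field L] [AddCommGroup E] [Module L E]
    [FiniteDimensional L E] (S : Set (Module.End L E))
    (hmul : ∀ a ∈ S, ∀ b ∈ S, a * b ∈ S) (hnil : ∀ a ∈ S, IsNilpotent a)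
    (W : Submodule L E) (hW : W ≠ ⊥) (hstab : ∀ s ∈ S, W.map s ≤ W) :
    ∃ v ∈ W, v ≠ 0 ∧ ∀ s ∈ S, s v = 0 := by
  induction W using WellFoundedLT.induction with
  | ind W IH =>
  by_cases h0 : ∀ s ∈ S, W.map s = ⊥
  · obtain ⟨v, hv, hv0⟩ := Submodule.exists_mem_ne_zero_of_ne_bot hW
    exact ⟨v, hv, hv0, fun s hs =>
      (Submodule.mem_bot L).1 (h0 s hs ▸ Submodule.mem_map_of_mem hv)⟩
  · let T : Set (Submodule L E) := {U | U ≠ ⊥ ∧ ∃ s ∈ S, W.map s = U}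
    have hT : T.Nonempty := by
      push Not at h0
      obtain ⟨s, hs, h⟩ := h0
      exact ⟨_, h, s, hs, rfl⟩
    -- A minimal nonzero image of `W` plays the role of an operator of minimal nonzero rank.
    obtain ⟨U, ⟨hU, a, haS, rfl⟩, hmin⟩ := WellFounded.has_min (wellFounded_lt) T hT
    -- A nonzero image of `b a` inside that of `a` equals it by minimality, so that `b` maps this
    -- nonzero space onto itself; this is impossible for a nilpotent `b`.
    have hkill : ∀ b ∈ S, b * a ∈ S → W.map (b * a) ≤ W.map a → W.map (b * a) = ⊥ := by
      intro b hb hba hle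
      by_contra hne
      have heq : W.map (b * a) = W.map a :=
        hle.eq_of_not_lt fun hlt => hmin _ ⟨hne, _, hba, rfl⟩ hlt
      have hpow : ∀ n : ℕ, (W.map a).map (b ^ n) = W.map a := by
        intro n
        induction n with
        | zero => simp [Module.End.one_eq_id]
        | succ n ihn =>
          rw [pow_succ, Module.End.mul_eq_comp, Submodule.map_comp, ← Submodule.map_comp a b,
            ← Module.End.mul_eq_comp, heq, ihn]
      obtain ⟨n, hn⟩ := hnil b hb
      have := hpow n
      rw [hn, Submodule.map_zero] at this
      exact hU this.symm
    have haa : W.map (a * a) = ⊥ := by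
      refine hkill a haS (hmul a haS a haS) ?_
      rw [Module.End.mul_eq_comp, Submodule.map_comp]
      exact Submodule.map_mono (hstab a haS)
    have hasa : ∀ s ∈ S, W.map (a * s * a) = ⊥ := by
      intro s hs
      refine hkill (a * s) (hmul a haS s hs) (hmul _ (hmul a haS s hs) a haS) ?_
      rw [mul_assoc, Module.End.mul_eq_comp, Submodule.map_comp]
      exact Submodule.map_mono (hstab _ (hmul s hs a haS))
    let W' : Submodule L E := W.map a ⊔ ⨆ s ∈ S, (W.map a).map s
    have hW'W : W' ≤ W :=
      sup_le (hstab a haS) (iSup₂_le fun s hs => (Submodule.map_mono (hstab a haS)).trans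
        (hstab s hs))
    have haW' : W'.map a = ⊥ := by
      rw [Submodule.map_sup, Submodule.map_iSup, ← Submodule.map_comp, ← Module.End.mul_eq_comp,
        haa, bot_sup_eq, iSup_eq_bot]
      intro s
      rw [Submodule.map_iSup, iSup_eq_bot]
      intro hs
      rw [← Submodule.map_comp, ← Submodule.map_comp, ← Module.End.mul_eq_comp,
        ← Module.End.mul_eq_comp, hasa s hs]
    have hlt : W' < W := by
      refine hW'W.lt_of_ne fun h => hU ?_
      rw [← h, haW']
    have hW'0 : W' ≠ ⊥ := fun h => hU (le_bot_iff.1 (h ▸ le_sup_left))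
    have hstab' : ∀ s ∈ S, W'.map s ≤ W' := by
      intro s hs
      rw [Submodule.map_sup, Submodule.map_iSup]
      refine sup_le ?_ (iSup_le fun r => ?_)
      · exact le_sup_of_le_right (le_iSup₂_of_le s hs le_rfl)
      · rw [Submodule.map_iSup]
        refine iSup_le fun hr => le_sup_of_le_right (le_iSup₂_of_le (s * r) (hmul s hs r hr) ?_)
        rw [← Submodule.map_comp, Module.End.mul_eq_comp]
    obtain ⟨v, hv, h⟩ := IH W' hlt hW'0 hstab'
    exact ⟨v, hW'W hv, h⟩

/-! ### Representations on a labelled basis -/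

/-- An arrow of the quiver together with its source and target. -/
abbrev Arrow (V : Type v) [Quiver.{w} V] : Type _ := (i : V) × (j : V) × (i ⟶ j)

section Labelled

variable {V : Type v} [Quiver.{w} V] {I : Type*} {L : Type*}

/-- A representation of the quiver on a space with basis `I`, where the basis vector `q` sits at
the vertex `ℓ q`: each arrow acts by a matrix on the total space whose `(p, q)` entry vanishes
unless the arrow goes from `ℓ q` to `ℓ p`. -/
def IsSupported [Zero L] (ℓ : I → V) (M : Arrow V → Matrix I I L) : Prop :=
  ∀ a p q, M a p q ≠ 0 → ℓ q = a.1 ∧ ℓ p = a.2.1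

/-- All nonempty products of the matrices `M a` are nilpotent. Products along words that are not
paths vanish when `M` is supported, so this is a condition on the oriented cycles. -/
def NilpotentWords [Fintype I] [DecidableEq I] [Semiring L] (M : Arrow V → Matrix I I L) : Prop :=
  ∀ w : List (Arrow V), w ≠ [] → IsNilpotent (w.map M).prod

/-- Twice the number of parameters needed for a nilpotent representation: each ordered pair of
distinct basis vectors contributes one parameter for being at the same vertex, and one for each
arrow from the first to the second. -/
noncomputable def pairCount [Fintype I] [DecidableEq I] [DecidableEq V] (ℓ : I → V) : ℕ :=
  ∑ p, ∑ q, if q = p then 0 else (if ℓ p = ℓ q then 1 else 0) + Nat.card (ℓ p ⟶ ℓ q)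

lemma pairCount_eq_add_remove (hsymm : IsSymmetric V) [Fintype I] [DecidableEq I]
    [DecidableEq V] (ℓ : I → V) (p : I) :
    pairCount ℓ = 2 * ∑ q : {q // q ≠ p}, ((if ℓ q.1 = ℓ p then 1 else 0) +
      Nat.card (ℓ q.1 ⟶ ℓ p)) + pairCount fun q : {q // q ≠ p} => ℓ q.1 := by
  have h1 : ∀ r : {q // q ≠ p}, (∑ q, if q = r.1 then 0 else
      (if ℓ r.1 = ℓ q then 1 else 0) + Nat.card (ℓ r.1 ⟶ ℓ q)) =
      ((if ℓ r.1 = ℓ p then 1 else 0) + Nat.card (ℓ r.1 ⟶ ℓ p)) +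
      ∑ q : {q // q ≠ p}, if q = r then 0 else
      (if ℓ r.1 = ℓ q.1 then 1 else 0) + Nat.card (ℓ r.1 ⟶ ℓ q.1) := by
    intro r
    rw [Fintype.sum_eq_add_sum_subtype_ne _ p, if_neg r.2.symm]
    simp only [Subtype.ext_iff]
  have h2 : (∑ q, if q = p then 0 else (if ℓ p = ℓ q then 1 else 0) + Nat.card (ℓ p ⟶ ℓ q)) =
      ∑ q : {q // q ≠ p}, ((if ℓ q.1 = ℓ p then 1 else 0) + Nat.card (ℓ q.1 ⟶ ℓ p)) := by
    rw [Fintype.sum_eq_add_sum_subtype_ne _ p, if_pos rfl, zero_add]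
    refine Finset.sum_congr rfl fun q _ => ?_
    rw [if_neg q.2, hsymm (ℓ p) (ℓ q.1)]
    simp only [eq_comm]
  unfold pairCount
  rw [Fintype.sum_eq_add_sum_subtype_ne _ p, h2, Finset.sum_congr rfl fun r _ => h1 r,
    Finset.sum_add_distrib (f := fun r : {q // q ≠ p} => _ + _), two_mul, add_assoc]

/-- A nilpotent representation has a nonzero vector, at a single vertex, killed by all arrows. -/
lemma exists_killed_vector [Fintype I] [DecidableEq I] [Nonempty I] [Field L] {ℓ : I → V}
    {M : Arrow V → Matrix I I L} (hM : IsSupported ℓ M) (hnil : NilpotentWords M) :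
    ∃ (p : I) (v : I → L), v p = 1 ∧ (∀ q, v q ≠ 0 → ℓ q = ℓ p) ∧ ∀ a, (M a).mulVec v = 0 := by
  classical
  let φ := Matrix.toLinAlgEquiv' (R := L) (n := I)
  obtain ⟨v, -, hv0, hv⟩ := exists_common_kernel_vector
    {f : Module.End L (I → L) | ∃ w : List (Arrow V), w ≠ [] ∧ φ (w.map M).prod = f}
    (by
      rintro _ ⟨w, hw, rfl⟩ _ ⟨w', -, rfl⟩
      exact ⟨w ++ w', by simp [hw], by simp⟩)
    (by
      rintro _ ⟨w, hw, rfl⟩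
      exact (hnil w hw).map φ)
    ⊤ top_ne_bot (fun _ _ => le_top)
  obtain ⟨p, hp⟩ := Function.ne_iff.1 hv0
  have hp : v p ≠ 0 := hp
  -- Arrows starting at `ℓ p` see only the component of `v` at that vertex, the others kill it.
  refine ⟨p, fun q => if ℓ q = ℓ p then (v p)⁻¹ * v q else 0, by simp [hp], fun q hq => ?_,
    fun a => ?_⟩
  · by_contra h
    simp [h] at hq
  · have ha : (M a).mulVec v = 0 := by
      have := hv (φ (([a] : List (Arrow V)).map M).prod) ⟨[a], by simp, rfl⟩
      simpa [φ] using this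
    ext r
    have har := congrFun ha r
    simp only [Matrix.mulVec, dotProduct, Pi.zero_apply] at har ⊢
    by_cases h : a.1 = ℓ p
    · rw [← mul_zero (v p)⁻¹, ← har, Finset.mul_sum]
      refine Finset.sum_congr rfl fun q _ => ?_
      by_cases hq : M a r q = 0
      · simp [hq]
      · rw [if_pos ((hM a r q hq).1.trans h)]
        ring
    · refine Finset.sum_eq_zero fun q _ => ?_
      by_cases hq : M a r q = 0
      · simp [hq]
      · rw [if_neg fun h' => h ((hM a r q hq).1.symm.trans h'), mul_zero]

/-- The quotient by the line spanned by `v`, where `v p = 1`, in the basis given by the images of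
the basis vectors other than `p`. -/
def quotientRep [CommRing L] (M : Arrow V → Matrix I I L) (p : I) (v : I → L) :
    Arrow V → Matrix {q // q ≠ p} {q // q ≠ p} L :=
  fun a => Matrix.of fun r q => M a r.1 q.1 - v r.1 * M a p q.1

/-- The matrix of the projection onto the quotient by the line spanned by `v`, where `v p = 1`. -/
def quotientProj [DecidableEq I] [CommRing L] (p : I) (v : I → L) : Matrix {q // q ≠ p} I L :=
  Matrix.of fun r q => (if q = r.1 then 1 else 0) - v r.1 * (if q = p then 1 else 0)

lemma apply_eq_neg_sum_of_killed [Fintype I] [DecidableEq I] [CommRing L] {N : Matrix I I L} {p : I}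
    {v : I → L} (hp : v p = 1) (hv : N.mulVec v = 0) (r : I) :
    N r p = -∑ q : {q // q ≠ p}, N r q.1 * v q.1 := by
  have h := congrFun hv r
  simp only [Matrix.mulVec, dotProduct, Pi.zero_apply] at h
  rw [Fintype.sum_eq_add_sum_subtype_ne _ p, hp, mul_one] at h
  exact eq_neg_of_add_eq_zero_left h

lemma quotientProj_mul [Fintype I] [DecidableEq I] [CommRing L] {M : Arrow V → Matrix I I L}
    {p : I} {v : I → L} (hp : v p = 1) (hv : ∀ a, (M a).mulVec v = 0) (a : Arrow V) :
    quotientProj p v * M a = quotientRep M p v a * quotientProj p v := by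
  ext r q
  have hl : (quotientProj p v * M a) r q = M a r.1 q - v r.1 * M a p q := by
    simp [Matrix.mul_apply, quotientProj, sub_mul, Finset.sum_sub_distrib]
  rw [hl]
  simp only [Matrix.mul_apply, quotientProj, quotientRep, Matrix.of_apply]
  by_cases h : q = p
  · subst h
    rw [apply_eq_neg_sum_of_killed hp (hv a) r.1, apply_eq_neg_sum_of_killed hp (hv a) q,
      mul_neg, sub_neg_eq_add, Finset.mul_sum, ← Finset.sum_neg_distrib, ← Finset.sum_add_distrib]
    refine Finset.sum_congr rfl fun s _ => ?_
    rw [if_neg s.2.symm, if_pos rfl]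
    ring
  · rw [Finset.sum_eq_single ⟨q, h⟩]
    · simp [h]
    · intro s _ hs
      rw [if_neg fun h' => hs (Subtype.ext h'.symm), if_neg h]
      ring
    · simp

lemma nilpotentWords_quotientRep [Fintype I] [DecidableEq I] [CommRing L]
    {M : Arrow V → Matrix I I L} {p : I} {v : I → L} (hp : v p = 1)
    (hv : ∀ a, (M a).mulVec v = 0) (hnil : NilpotentWords M) :
    NilpotentWords (quotientRep M p v) := by
  intro w hw
  have h1 : quotientProj p v * (w.map M).prod =
      (w.map (quotientRep M p v)).prod * quotientProj p v := by
    clear hw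
    induction w with
    | nil => simp
    | cons a w ih =>
      rw [List.map_cons, List.prod_cons, List.map_cons, List.prod_cons, ← Matrix.mul_assoc,
        quotientProj_mul hp hv, Matrix.mul_assoc, ih, Matrix.mul_assoc]
  obtain ⟨n, hn⟩ := hnil w hw
  refine ⟨n, ?_⟩
  set A := (w.map M).prod
  set A' := (w.map (quotientRep M p v)).prod
  have h2 : ∀ n : ℕ, quotientProj p v * A ^ n = A' ^ n * quotientProj p v := by
    intro n
    induction n with
    | zero => simp
    | succ n ih => rw [pow_succ, ← Matrix.mul_assoc, ih, Matrix.mul_assoc, h1, pow_succ,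
        Matrix.mul_assoc]
  have h3 := h2 n
  rw [hn, Matrix.mul_zero] at h3
  ext r q
  have h4 := congrFun (congrFun h3 r) q.1
  rw [Matrix.mul_apply, Finset.sum_eq_single q] at h4
  · simpa [quotientProj, q.2] using h4.symm
  · intro s _ hs
    simp [quotientProj, q.2, ← Subtype.ext_iff, hs.symm]
  · simp

lemma isSupported_quotientRep [CommRing L] {ℓ : I → V} {M : Arrow V → Matrix I I L}
    (hM : IsSupported ℓ M) {p : I} {v : I → L} (hvℓ : ∀ q, v q ≠ 0 → ℓ q = ℓ p) :
    IsSupported (fun q : {q // q ≠ p} => ℓ q.1) (quotientRep M p v) := by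
  intro a r q h
  simp only [quotientRep, Matrix.of_apply] at h
  by_cases h1 : M a r.1 q.1 = 0
  · rw [h1, zero_sub, neg_ne_zero] at h
    have h2 := hM a p q.1 (right_ne_zero_of_mul h)
    exact ⟨h2.1, (hvℓ r.1 (left_ne_zero_of_mul h)).trans h2.2⟩
  · exact hM a r.1 q.1 h1

/-- All matrix entries of a nilpotent representation are polynomials in `pairCount ℓ / 2` elements.
Splitting off a killed vector `v` with `v p = 1`, the representation is recovered from its
quotient, the coordinates of `v` other than `v p`, and the entries of row `p` outside column
`p`. -/
theorem exists_finset_mem_adjoin [∀ i j : V, Finite (i ⟶ j)] (hsymm : IsSymmetric V)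
    (K : Type*) [Field K] [Field L] [Algebra K L] [Fintype I] [DecidableEq I]
    [DecidableEq V] {ℓ : I → V} {M : Arrow V → Matrix I I L} (hM : IsSupported ℓ M)
    (hnil : NilpotentWords M) :
    ∃ t : Finset L, 2 * t.card ≤ pairCount ℓ ∧
      ∀ a p q, M a p q ∈ Algebra.adjoin K (t : Set L) := by
  induction hn : Fintype.card I generalizing I with
  | zero =>
    have := Fintype.card_eq_zero_iff.1 hn
    exact ⟨∅, by simp, fun a p => isEmptyElim p⟩
  | succ n IH =>
    have : Nonempty I := Fintype.card_pos_iff.1 (by omega)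
    obtain ⟨p, v, hp, hvℓ, hv⟩ := exists_killed_vector hM hnil
    obtain ⟨t', ht', hM'⟩ := IH (isSupported_quotientRep hM hvℓ)
      (nilpotentWords_quotientRep hp hv hnil) (by simp [hn])
    classical
    have := fun i j : V => Fintype.ofFinite (i ⟶ j)
    let s : {q // q ≠ p} → Finset L := fun q =>
      (if ℓ q.1 = ℓ p then {v q.1} else ∅) ∪
        Finset.univ.image fun a : ℓ q.1 ⟶ ℓ p => M ⟨_, _, a⟩ p q.1
    have hs : ∀ q, (s q).card ≤ (if ℓ q.1 = ℓ p then 1 else 0) + Nat.card (ℓ q.1 ⟶ ℓ p) := by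
      intro q
      refine (Finset.card_union_le _ _).trans (add_le_add ?_ ?_)
      · split_ifs <;> simp
      · rw [Nat.card_eq_fintype_card]
        exact Finset.card_image_le
    refine ⟨t' ∪ Finset.univ.biUnion s, ?_, ?_⟩
    · have h1 : (t' ∪ Finset.univ.biUnion s).card ≤ t'.card + ∑ q : {q // q ≠ p},
          ((if ℓ q.1 = ℓ p then 1 else 0) + Nat.card (ℓ q.1 ⟶ ℓ p)) :=
        (Finset.card_union_le _ _).trans (add_le_add le_rfl
          (Finset.card_biUnion_le.trans (Finset.sum_le_sum fun q _ => hs q)))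
      rw [pairCount_eq_add_remove hsymm ℓ p]
      omega
    · set A := Algebra.adjoin K ((t' ∪ Finset.univ.biUnion s : Finset L) : Set L)
      have hsA : ∀ q, ∀ x ∈ s q, x ∈ A := fun q x hx => Algebra.subset_adjoin (by
        rw [Finset.mem_coe, Finset.mem_union, Finset.mem_biUnion]
        exact Or.inr ⟨q, Finset.mem_univ q, hx⟩)
      have hMA : ∀ a r q, quotientRep M p v a r q ∈ A := fun a r q =>
        Algebra.adjoin_mono (by simp) (hM' a r q)
      have hvA : ∀ q : {q // q ≠ p}, v q.1 ∈ A := by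
        intro q
        by_cases h : v q.1 = 0
        · exact h ▸ A.zero_mem
        · exact hsA q _ (by simp [s, hvℓ _ h])
      have hrow : ∀ a (q : {q // q ≠ p}), M a p q.1 ∈ A := by
        rintro ⟨i, j, a⟩ q
        by_cases h : M ⟨i, j, a⟩ p q.1 = 0
        · exact h ▸ A.zero_mem
        · obtain ⟨h1, h2⟩ := hM _ _ _ h
          dsimp only at h1 h2
          subst h1 h2
          exact hsA q _ (Finset.mem_union_right _ (Finset.mem_image_of_mem _ (Finset.mem_univ a)))
      have hcol : ∀ a r (q : {q // q ≠ p}), M a r q.1 ∈ A := by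
        intro a r q
        by_cases h : r = p
        · exact h ▸ hrow a q
        · have h1 := A.add_mem (hMA a ⟨r, h⟩ q) (A.mul_mem (hvA ⟨r, h⟩) (hrow a q))
          simpa [quotientRep] using h1
      intro a r q
      by_cases h : q = p
      · subst h
        rw [apply_eq_neg_sum_of_killed hp (hv a) r]
        exact A.neg_mem (A.sum_mem fun s _ => A.mul_mem (hcol a r s) (hvA s))
      · exact hcol a r ⟨q, h⟩

end Labelled

/-! ### Invariants and the nullcone -/

section Gauge

variable {V : Type v} {d : V →₀ ℕ}

/-- The standard basis of the total space `⨁ i, A ^ d i` of a representation. -/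
abbrev TotalBasis (d : V →₀ ℕ) : Type _ := (i : V) × Fin (d i)

/-- Only the vertices in the support of `d` contribute to the total space. -/
instance (d : V →₀ ℕ) : Fintype (TotalBasis d) where
  elems := d.support.sigma fun _ => Finset.univ
  complete p := by simpa using p.2.pos.ne'

variable [DecidableEq V] {A : Type*} [CommRing A]

/-- The inclusion of the space at the vertex `i` into the total space. -/
def incl (d : V →₀ ℕ) (A : Type*) [CommRing A] (i : V) : Matrix (TotalBasis d) (Fin (d i)) A :=
  Matrix.of fun p r => if p = ⟨i, r⟩ then 1 else 0

/-- The block diagonal action of the gauge group on the total space. -/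
def totalGauge (g : GaugeGroup d A) : Matrix (TotalBasis d) (TotalBasis d) A :=
  Matrix.blockDiagonal' fun i => (g i).val

lemma totalGauge_mul_incl (g : GaugeGroup d A) (i : V) :
    totalGauge g * incl d A i = incl d A i * (g i).val := by
  ext ⟨k, r⟩ c
  by_cases h : k = i
  · subst h
    simp [totalGauge, incl, Matrix.mul_apply]
  · simp [totalGauge, incl, Matrix.mul_apply, Matrix.blockDiagonal'_apply_ne _ _ _ h, h]

lemma incl_transpose_mul_totalGauge (g : GaugeGroup d A) (i : V) :
    (incl d A i).transpose * totalGauge g = (g i).val * (incl d A i).transpose := by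
  ext c ⟨k, r⟩
  by_cases h : k = i
  · subst h
    simp [totalGauge, incl, Matrix.mul_apply]
  · simp [totalGauge, incl, Matrix.mul_apply, Matrix.blockDiagonal'_apply_ne _ _ _ (Ne.symm h), h]

lemma eq_of_mul_incl {M N : Matrix (TotalBasis d) (TotalBasis d) A}
    (h : ∀ i, M * incl d A i = N * incl d A i) : M = N := by
  ext p ⟨i, r⟩
  have := congrFun (congrFun (h i) p) r
  simpa [Matrix.mul_apply, incl] using this

lemma totalGauge_mul_inv (g : GaugeGroup d A) : totalGauge g * totalGauge g⁻¹ = 1 := by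
  refine eq_of_mul_incl fun i => ?_
  rw [Matrix.mul_assoc, totalGauge_mul_incl, ← Matrix.mul_assoc, totalGauge_mul_incl,
    Matrix.mul_assoc, Matrix.one_mul, ← Units.val_mul, Pi.inv_apply, mul_inv_cancel, Units.val_one,
    Matrix.mul_one]

end Gauge

section Invariants

variable {V : Type v} [Quiver.{w} V] {d : V →₀ ℕ}

instance [∀ i j : V, Finite (i ⟶ j)] : Finite (RepCoord d) :=
  Finite.of_surjective
    (fun c : (p : TotalBasis d) × (q : TotalBasis d) × (q.1 ⟶ p.1) =>
      (⟨c.2.1.1, c.1.1, c.2.2, c.1.2, c.2.1.2⟩ : RepCoord d))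
    fun c => ⟨⟨⟨c.2.1, c.2.2.2.1⟩, ⟨c.1, c.2.2.2.2⟩, c.2.2.1⟩, rfl⟩

variable {A : Type*} [CommRing A]

variable {K : Type u} [Field K]

lemma mem_of_mem_nullcone {P : PrimeSpectrum (RepRing K d)} (hP : P ∈ nullcone K d)
    {f : RepRing K d} (hf : f ∈ invariantRing K d) (h0 : evalAt (0 : RepSpace d K) f = 0) :
    f ∈ P.asIdeal := by
  have h : quotientMap K d P = quotientMap K d (origin K d) := hP
  have h1 : (⟨f, hf⟩ : invariantRing K d) ∈ (quotientMap K d (origin K d)).asIdeal := h0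
  rw [← h] at h1
  exact h1

/-- The nullcone is closed in `R_d`: the image of the origin is a closed point, because evaluation
at the origin maps the invariants onto `K`. -/
lemma exists_nullcone_eq_zeroLocus :
    ∃ J : Ideal (RepRing K d), nullcone K d = PrimeSpectrum.zeroLocus (J : Set (RepRing K d)) := by
  let ι := algebraMap (invariantRing K d) (RepRing K d)
  let m := (quotientMap K d (origin K d)).asIdeal
  have hm : m.IsMaximal := by
    let ε : invariantRing K d →ₐ[K] K := (evalAt (0 : RepSpace d K)).comp (invariantRing K d).val
    have hε : Function.Surjective ε := fun r => ⟨algebraMap K _ r, ε.commutes r⟩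
    exact RingHom.ker_isMaximal_of_surjective ε hε
  refine ⟨m.map ι, Set.ext fun P => ?_⟩
  rw [PrimeSpectrum.mem_zeroLocus, SetLike.coe_subset_coe, Ideal.map_le_iff_le_comap]
  constructor
  · intro h
    exact (congrArg PrimeSpectrum.asIdeal (show quotientMap K d P = _ from h)).ge
  · intro h
    exact PrimeSpectrum.ext (hm.eq_of_le (quotientMap K d P).isPrime.ne_top h).symm

variable [DecidableEq V]

/-- The action of an arrow on the total space of a representation. -/
def totalMat (x : RepSpace d A) (a : Arrow V) : Matrix (TotalBasis d) (TotalBasis d) A :=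
  incl d A a.2.1 * x a.1 a.2.1 a.2.2 * (incl d A a.1).transpose

/-- The action of the path algebra element given by a word of arrows; it is zero if consecutive
arrows are not composable. -/
def wordMat (x : RepSpace d A) (w : List (Arrow V)) : Matrix (TotalBasis d) (TotalBasis d) A :=
  (w.map (totalMat x)).prod

lemma totalMat_apply (x : RepSpace d A) {i j : V} (a : i ⟶ j) (r : Fin (d j)) (c : Fin (d i)) :
    totalMat x ⟨i, j, a⟩ ⟨j, r⟩ ⟨i, c⟩ = x i j a r c := by
  simp [totalMat, Matrix.mul_apply, incl]

lemma isSupported_totalMat (x : RepSpace d A) : IsSupported Sigma.fst (totalMat x) := by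
  rintro ⟨i, j, a⟩ ⟨j', r⟩ ⟨i', c⟩ h
  by_contra h'
  refine h ?_
  simp only [totalMat, Matrix.mul_apply, incl, Matrix.of_apply, Matrix.transpose_apply]
  dsimp only at h'
  by_cases hi : i' = i
  · have hj : j' ≠ j := fun hj => h' ⟨hi, hj⟩
    simp [hj]
  · simp [hi]

lemma totalMat_map {B : Type*} [CommRing B] (f : A →+* B) (x : RepSpace d A) (a : Arrow V) :
    (totalMat x a).map f = totalMat (fun i j b => (x i j b).map f) a := by
  have h : ∀ i, (incl d A i).map f = incl d B i := by
    intro i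
    ext p r
    simp [incl, apply_ite f]
  rw [totalMat, totalMat, Matrix.map_mul, Matrix.map_mul, Matrix.transpose_map, h, h]

lemma wordMat_map {B : Type*} [CommRing B] (f : A →+* B) (x : RepSpace d A) (w : List (Arrow V)) :
    f.mapMatrix (wordMat x w) = wordMat (fun i j b => (x i j b).map f) w := by
  rw [wordMat, map_list_prod, List.map_map, wordMat]
  congr 1
  refine List.map_congr_left fun a _ => ?_
  exact totalMat_map f x a

lemma wordMat_zero (w : List (Arrow V)) (hw : w ≠ []) : wordMat (0 : RepSpace d A) w = 0 := by
  obtain ⟨a, w, rfl⟩ := List.exists_cons_of_ne_nil hw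
  have : totalMat (0 : RepSpace d A) a = 0 := by
    simp [totalMat]
  rw [wordMat, List.map_cons, List.prod_cons, this, zero_mul]

lemma totalMat_conjAct (g : GaugeGroup d A) (x : RepSpace d A) (a : Arrow V) :
    totalMat (conjAct g x) a = totalGauge g * totalMat x a * totalGauge g⁻¹ := by
  simp only [totalMat, conjAct, Matrix.mul_assoc, incl_transpose_mul_totalGauge]
  simp only [← Matrix.mul_assoc, totalGauge_mul_incl]
  rfl

lemma wordMat_conjAct (g : GaugeGroup d A) (x : RepSpace d A) (w : List (Arrow V)) :
    wordMat (conjAct g x) w = totalGauge g * wordMat x w * totalGauge g⁻¹ := by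
  induction w with
  | nil => simp [wordMat, totalGauge_mul_inv]
  | cons a w ih =>
    have h : totalGauge g⁻¹ * totalGauge g = 1 := by simpa using totalGauge_mul_inv g⁻¹
    simp only [wordMat, List.map_cons, List.prod_cons] at ih ⊢
    rw [ih, totalMat_conjAct]
    simp only [Matrix.mul_assoc]
    rw [← Matrix.mul_assoc (totalGauge g⁻¹) (totalGauge g), h, Matrix.one_mul]

lemma charpoly_wordMat_conjAct (g : GaugeGroup d A) (x : RepSpace d A) (w : List (Arrow V)) :
    (wordMat (conjAct g x) w).charpoly = (wordMat x w).charpoly := by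
  have h : totalGauge g⁻¹ * totalGauge g = 1 := by simpa using totalGauge_mul_inv g⁻¹
  rw [wordMat_conjAct, Matrix.charpoly_mul_comm, ← Matrix.mul_assoc, h, Matrix.one_mul]

variable (K)

/-- The generic representation, whose matrix entries are the coordinate functions on `R_d`. -/
noncomputable def genericRep (d : V →₀ ℕ) : RepSpace d (RepRing K d) :=
  fun i j a => Matrix.of fun r c => MvPolynomial.X ⟨i, j, a, r, c⟩

variable {K}

lemma evalAt_charpoly_coeff [Algebra K A] (x : RepSpace d A) (w : List (Arrow V)) (k : ℕ) :
    evalAt x ((wordMat (genericRep K d) w).charpoly.coeff k) = (wordMat x w).charpoly.coeff k := by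
  have h := wordMat_map (evalAt (K := K) x).toRingHom (genericRep K d) w
  have hx : (fun i j b => (genericRep K d i j b).map (evalAt (K := K) x).toRingHom) = x := by
    funext i j b
    ext r c
    simp [genericRep, evalAt]
  rw [hx] at h
  rw [← h, RingHom.mapMatrix_apply, Matrix.charpoly_map, Polynomial.coeff_map]
  rfl

lemma charpoly_coeff_mem_invariantRing (w : List (Arrow V)) (k : ℕ) :
    (wordMat (genericRep K d) w).charpoly.coeff k ∈ invariantRing K d := by
  intro A _ _ g x
  rw [evalAt_charpoly_coeff, evalAt_charpoly_coeff, charpoly_wordMat_conjAct]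

/-- At a point of the nullcone, every word acts nilpotently: the lower coefficients of its
characteristic polynomial are invariants vanishing at the origin. -/
lemma nilpotentWords_of_mem_nullcone [Algebra K A] [Nontrivial A]
    {P : PrimeSpectrum (RepRing K d)} (hP : P ∈ nullcone K d) (x : RepSpace d A)
    (hx : P.asIdeal ≤ RingHom.ker (evalAt (K := K) x)) : NilpotentWords (totalMat x) := by
  intro w hw
  change IsNilpotent (wordMat x w)
  have hc : (wordMat x w).charpoly = Polynomial.X ^ Fintype.card (TotalBasis d) := by
    have hdeg := (wordMat x w).charpoly_natDegree_eq_dim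
    have hmon := (wordMat x w).charpoly_monic
    ext k
    rw [Polynomial.coeff_X_pow]
    rcases lt_trichotomy k (Fintype.card (TotalBasis d)) with hk | rfl | hk
    · rw [if_neg hk.ne, ← evalAt_charpoly_coeff (K := K)]
      refine hx (mem_of_mem_nullcone hP (charpoly_coeff_mem_invariantRing w k) ?_)
      rw [evalAt_charpoly_coeff, wordMat_zero w hw, Matrix.charpoly_zero, Polynomial.coeff_X_pow,
        if_neg hk.ne]
    · rw [if_pos rfl, ← hdeg]
      exact hmon
    · rw [if_neg hk.ne', Polynomial.coeff_eq_zero_of_natDegree_lt (hdeg ▸ hk)]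
  refine ⟨Fintype.card (TotalBasis d), ?_⟩
  have := (wordMat x w).aeval_self_charpoly
  rwa [hc, map_pow, Polynomial.aeval_X] at this

/-! ### The dimension of the nullcone -/

/-- The closure of a point of the nullcone has dimension at most `pairCount / 2`: the residue field
carries a tautological representation, which is nilpotent. -/
lemma ringKrullDim_quotient_le_of_mem_nullcone [∀ i j : V, Finite (i ⟶ j)] (hsymm : IsSymmetric V)
    {P : PrimeSpectrum (RepRing K d)} (hP : P ∈ nullcone K d) :
    ringKrullDim (RepRing K d ⧸ P.asIdeal) ≤
      (pairCount (Sigma.fst : TotalBasis d → V) / 2 : ℕ) := by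
  let L := FractionRing (RepRing K d ⧸ P.asIdeal)
  let π : RepRing K d →ₐ[K] L := (IsScalarTower.toAlgHom K (RepRing K d ⧸ P.asIdeal) L).comp
    (Ideal.Quotient.mkₐ K P.asIdeal)
  let x : RepSpace d L := fun i j a => (genericRep K d i j a).map π
  have hev : evalAt (K := K) x = π := by
    ext c
    simp [evalAt, x, genericRep]
  have hnil : NilpotentWords (totalMat x) := by
    refine nilpotentWords_of_mem_nullcone hP x fun f hf => ?_
    rw [hev]
    simp [π, RingHom.mem_ker, Ideal.Quotient.eq_zero_iff_mem.2 hf]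
  obtain ⟨t, ht, hmem⟩ := exists_finset_mem_adjoin hsymm K (isSupported_totalMat x) hnil
  have hX : ∀ c, π (MvPolynomial.X c) ∈ Algebra.adjoin K (t : Set L) := by
    rintro ⟨i, j, a, r, c⟩
    have := hmem ⟨i, j, a⟩ ⟨j, r⟩ ⟨i, c⟩
    rwa [totalMat_apply] at this
  have hπ : ∀ f, π f ∈ Algebra.adjoin K (t : Set L) := by
    intro f
    induction f using MvPolynomial.induction_on with
    | C r =>
      have := (Algebra.adjoin K (t : Set L)).algebraMap_mem r
      rwa [← π.commutes] at this
    | add p q hp hq => exact map_add π p q ▸ add_mem hp hq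
    | mul_X p c hp => exact map_mul π p _ ▸ mul_mem hp (hX c)
  refine (ringKrullDim_le_card_of_mem_adjoin (IsScalarTower.toAlgHom K _ L)
    (IsFractionRing.injective _ L) t fun b => ?_).trans ?_
  · obtain ⟨f, rfl⟩ := Ideal.Quotient.mk_surjective b
    exact hπ f
  · have : t.card ≤ pairCount (Sigma.fst : TotalBasis d → V) / 2 := by omega
    exact_mod_cast this

/-- The nullcone has finite dimension, at most the number of parameters of a nilpotent
representation. -/
lemma exists_topologicalKrullDim_nullcone [∀ i j : V, Finite (i ⟶ j)] (hsymm : IsSymmetric V) :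
    ∃ n : ℕ, topologicalKrullDim (nullcone K d) = n ∧
      2 * n ≤ pairCount (Sigma.fst : TotalBasis d → V) := by
  obtain ⟨J, hJ⟩ := exists_nullcone_eq_zeroLocus (K := K) (d := d)
  have hle : ringKrullDim (RepRing K d ⧸ J) ≤
      (pairCount (Sigma.fst : TotalBasis d → V) / 2 : ℕ) := by
    refine ringKrullDim_quotient_le_of_forall_isPrime J _ fun P hP hJP => ?_
    have hmem : (⟨P, hP⟩ : PrimeSpectrum (RepRing K d)) ∈ nullcone K d := by
      rw [hJ]
      exact hJP
    exact ringKrullDim_quotient_le_of_mem_nullcone (P := ⟨P, hP⟩) hsymm hmem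
  have hJtop : J ≠ ⊤ := by
    have : origin K d ∈ nullcone K d := Set.mem_preimage.2 (Set.mem_singleton _)
    rw [hJ] at this
    exact ne_top_of_le_ne_top (origin K d).isPrime.ne_top this
  have : Nontrivial (RepRing K d ⧸ J) := Ideal.Quotient.nontrivial_iff.2 hJtop
  rw [hJ, topologicalKrullDim_zeroLocus]
  have h0 : 0 ≤ ringKrullDim (RepRing K d ⧸ J) := ringKrullDim_nonneg_of_nontrivial
  obtain ⟨n, hn⟩ := WithBot.ne_bot_iff_exists.1 (h0.trans_lt' (WithBot.bot_lt_coe _)).ne'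
  rw [← hn] at hle ⊢
  lift n to ℕ using fun h => by
    subst h
    exact absurd hle (by exact_mod_cast ENat.natCast_lt_top _ |>.not_ge)
  refine ⟨n, rfl, ?_⟩
  have : n ≤ pairCount (Sigma.fst : TotalBasis d → V) / 2 := by exact_mod_cast hle
  omega

end Invariants

/-! ### The dimension of the gauge group and the Euler pairing -/

section GaugeDimension

variable {V : Type v} (K : Type u) [Field K] (d : V →₀ ℕ)

/-- The index set of the entries of a tuple of square matrices of sizes `d i`. -/
instance : Fintype ((i : V) × (Fin (d i) × Fin (d i))) where
  elems := d.support.sigma fun _ => Finset.univ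
  complete p := by simpa using p.2.1.pos.ne'

lemma card_gaugeCoord :
    Nat.card ((i : V) × (Fin (d i) × Fin (d i))) = ∑ i ∈ d.support, d i * d i := by
  rw [Nat.card_eq_fintype_card, Fintype.card]
  exact (Finset.card_sigma _ _).trans (by simp)

lemma topologicalKrullDim_gaugeRing :
    topologicalKrullDim (PrimeSpectrum (GaugeRing K d)) = (∑ i ∈ d.support, d i * d i : ℕ) := by
  rw [PrimeSpectrum.topologicalKrullDim_eq_ringKrullDim, ← card_gaugeCoord]
  refine ringKrullDim_away_mvPolynomial _ fun h => ?_
  classical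
  -- The product of the determinants takes the value `1` at the tuple of identity matrices.
  let φ : MvPolynomial ((i : V) × (Fin (d i) × Fin (d i))) K →ₐ[K] K :=
    MvPolynomial.aeval fun c => if c.2.1 = c.2.2 then 1 else 0
  have h1 : ∀ i, φ (Matrix.det (Matrix.of fun r c : Fin (d i) =>
      (MvPolynomial.X ⟨i, r, c⟩ : MvPolynomial ((i : V) × (Fin (d i) × Fin (d i))) K))) = 1 := by
    intro i
    rw [AlgHom.map_det, ← Matrix.det_one (n := Fin (d i))]
    congr 1
    ext r c
    simp [φ, Matrix.one_apply]
  have h2 := congrArg φ h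
  simp only [map_prod, h1, Finset.prod_const_one, map_zero, one_ne_zero] at h2

lemma sum_totalBasis {R : Type*} [CommRing R] (f : V → R) :
    ∑ p : TotalBasis d, f p.1 = ∑ i ∈ d.support, (d i : R) * f i := by
  refine (Finset.sum_sigma d.support (fun i => (Finset.univ : Finset (Fin (d i))))
    (fun p => f p.1)).trans ?_
  simp

end GaugeDimension

section Numerics

variable {V : Type v} [Quiver.{w} V] (d : V →₀ ℕ)

lemma eulerPairing_intVec_self : eulerPairing (intVec d) (intVec d) =
    (∑ i ∈ d.support, d i * d i : ℕ) -
      ∑ i ∈ d.support, ∑ j ∈ d.support, (d i : ℤ) * (d j * (Nat.card (i ⟶ j) : ℤ)) := by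
  have h : ∀ (f : V → ℤ → ℤ), (∀ i, f i 0 = 0) →
      (intVec d).sum f = ∑ i ∈ d.support, f i (d i) := fun f hf =>
    Finsupp.sum_mapRange_index hf
  rw [eulerPairing, h _ (by simp), h _ (by simp)]
  congr 1
  · simp [intVec]
  · refine Finset.sum_congr rfl fun i _ => ?_
    rw [h _ (by simp)]
    exact Finset.sum_congr rfl fun j _ => by ring

lemma eulerPairing_single_self (k : V) :
    eulerPairing (Finsupp.single k (1 : ℤ)) (Finsupp.single k 1) = 1 - (Nat.card (k ⟶ k) : ℤ) := by
  simp [eulerPairing]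

lemma pairCount_totalBasis [DecidableEq V] : (pairCount (Sigma.fst : TotalBasis d → V) : ℤ) =
    (∑ i ∈ d.support, d i * d i : ℕ) +
      ∑ i ∈ d.support, ∑ j ∈ d.support, (d i : ℤ) * (d j * (Nat.card (i ⟶ j) : ℤ)) -
      ∑ i ∈ d.support, (d i : ℤ) * (1 + Nat.card (i ⟶ i)) := by
  let c : V → V → ℤ := fun i j => (if i = j then 1 else 0) + Nat.card (i ⟶ j)
  have h1 : ∀ p : TotalBasis d, (∑ q : TotalBasis d, if q = p then 0 else c p.1 q.1) =
      (∑ q : TotalBasis d, c p.1 q.1) - c p.1 p.1 := by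
    intro p
    rw [eq_sub_iff_add_eq, ← Finset.sum_erase_add _ _ (Finset.mem_univ p), if_pos rfl, add_zero,
      ← Finset.sum_erase_add _ (fun q : TotalBasis d => c p.1 q.1) (Finset.mem_univ p)]
    congr 1
    exact Finset.sum_congr rfl fun q hq => if_neg (Finset.ne_of_mem_erase hq)
  have h2 : (pairCount (Sigma.fst : TotalBasis d → V) : ℤ) =
      ∑ p : TotalBasis d, ∑ q : TotalBasis d, if q = p then 0 else c p.1 q.1 := by
    rw [pairCount]
    push_cast
    rfl
  rw [h2, Finset.sum_congr rfl fun p _ => h1 p, Finset.sum_sub_distrib]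
  congr 1
  · rw [Finset.sum_congr rfl fun p _ => sum_totalBasis d (c p.1),
      sum_totalBasis d fun i => ∑ j ∈ d.support, (d j : ℤ) * c i j]
    push_cast
    rw [← Finset.sum_add_distrib]
    refine Finset.sum_congr rfl fun i _ => ?_
    simp only [c, mul_add, Finset.sum_add_distrib, Finset.mul_sum]
    congr 1
    rw [Finset.sum_eq_single i] <;> simp +contextual [eq_comm]
  · rw [sum_totalBasis d fun i => c i i]
    simp [c]

end Numerics

end SymQuiver

theorem mainTheorem8 {K : Type u} [Field K] {V : Type v} [Quiver.{w} V]
    [∀ i j : V, Finite (i ⟶ j)] (hsymm : SymQuiver.IsSymmetric V) (d : V →₀ ℕ) :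
    ∃ n g : ℕ,
      topologicalKrullDim (SymQuiver.nullcone K d) = n ∧
      topologicalKrullDim (PrimeSpectrum (SymQuiver.GaugeRing K d)) = g ∧
      (n : ℚ) - (g : ℚ) ≤
        -(1 / 2) * (SymQuiver.eulerPairing (SymQuiver.intVec d) (SymQuiver.intVec d) : ℚ)
        + 1 / 2 * (d.sum fun k m =>
            (SymQuiver.eulerPairing (Finsupp.single k (1 : ℤ)) (Finsupp.single k 1) : ℚ) * (m : ℚ))
        - (d.sum fun _ m => (m : ℚ)) := by
  classical
  obtain ⟨n, hn, hle⟩ := SymQuiver.exists_topologicalKrullDim_nullcone (K := K) (d := d) hsymm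
  refine ⟨n, _, hn, SymQuiver.topologicalKrullDim_gaugeRing K d, ?_⟩
  have hle' := (Int.cast_le (R := ℚ)).2
    ((Int.ofNat_le.2 hle).trans_eq (SymQuiver.pairCount_totalBasis d))
  have hk : (d.sum fun k m => (SymQuiver.eulerPairing (Finsupp.single k (1 : ℤ))
      (Finsupp.single k 1) : ℚ) * (m : ℚ)) = 2 * (d.sum fun _ m => (m : ℚ)) -
      ∑ i ∈ d.support, (d i : ℚ) * (1 + Nat.card (i ⟶ i)) := by
    rw [Finsupp.sum, Finsupp.sum, Finset.mul_sum, ← Finset.sum_sub_distrib]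
    refine Finset.sum_congr rfl fun i _ => ?_
    rw [SymQuiver.eulerPairing_single_self]
    push_cast
    ring
  rw [hk, SymQuiver.eulerPairing_intVec_self]
  push_cast at hle' ⊢
  linarith
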